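/- Let $\alpha,\beta>0$ be real, $L\ge 1$ an integer, $\rho=\alpha/\beta$, and let $\rho\le\theta<1$. Let $\mathcal V$ be the set of real sequences $v=(v(k))_{k\ge 0}$ with $v(0)=1$, $v(k)\ge v(k+1)$ for all $k\ge 0$, and $\lim_{k\to\infty}v(k)=0$. For a sequence $x=(x(k))_{k\ge 0}$ put $\Vert x\Vert_{L_2(g_\theta)}=\bigl(\sum_{k\ge1}x(k)^2\theta^{-k}\bigr)^{1/2}$, let $L_2(g_\theta)$ be the space of sequences with $x(0)=0$ and $\Vert x\Vert_{L_2(g_\theta)}<\infty$, and let $\mathcal V\cap L_2(g_\theta)$ denote (by abuse of notation) the set of $v\in\mathcal V$ with $\sum_{k\ge1}v(k)^2\theta^{-k}<\infty$. Let $\tilde u\in\mathcal V$ be given by $\tilde u(0)=1$ and $\tilde u(k)=\rho^{L^{k-1}+L^{k-2}+\cdots+1}$ for $k\ge1$. Then there are constants $\gamma_\theta>0$ and $C_\theta<\infty$ (depending only on $\alpha,\beta,L,\theta$) such that for every solution $u=(u_t)_{t\ge0}$ with values in $\mathcal V$ of $$\dot u_t(k)=\alpha\bigl(u_t(k-1)^L-u_t(k)^L\bigr)-\beta\bigl(u_t(k)-u_t(k+1)\bigr),\qquad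 k\ge1,\ t\ge0,$$ such that $u_0\in\mathcal V\cap L_2(g_\theta)$, one has, for all $t\ge0$, $u_t-\tilde u\in L_2(g_\theta)$ and $$\Vert u_t-\tilde u\Vert_{L_2(g_\theta)}\le e^{-\gamma_\theta t}\,C_\theta\,\Vert u_0-\tilde u\Vert_{L_2(g_\theta)}.$$ -/

import Mathlib

namespace LoadBalancing

open Filter Topology

/-- The set `𝒱` of tails of probability measures on `ℕ`: real sequences with `v 0 = 1`,
`v k ≥ v (k + 1)` and limit `0`. -/
def tails : Set (ℕ → ℝ) :=
  {v | v 0 = 1 ∧ (∀ k, v (k + 1) ≤ v k) ∧ Tendsto v atTop (𝓝 0)}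

/-- The geometric sequence `g_θ(k) = θ ^ k` (used for `k ≥ 1`). -/
def geom (θ : ℝ) (k : ℕ) : ℝ := θ ^ k

/-- Finiteness of `∑_{k ≥ 1} x(k)² / w(k)`; the index `k ≥ 1` is written `k + 1` with `k : ℕ`. -/
def SqSummable (w x : ℕ → ℝ) : Prop :=
  Summable fun k : ℕ => x (k + 1) ^ 2 * (w (k + 1))⁻¹

/-- The Hilbert space `L₂(w)`, as a set of sequences vanishing at `0`. -/
def L2 (w : ℕ → ℝ) : Set (ℕ → ℝ) :=
  {x | x 0 = 0 ∧ SqSummable w x}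

/-- The norm `‖x‖_{L₂(w)} = (∑_{k ≥ 1} x(k)² / w(k))^{1/2}`. -/
noncomputable def L2norm (w x : ℕ → ℝ) : ℝ :=
  Real.sqrt (∑' k : ℕ, x (k + 1) ^ 2 * (w (k + 1))⁻¹)

/-- The set `𝒱 ∩ L₂(w)`. Elements of `𝒱` equal `1` at index `0`, so membership in `L₂(w)` means here
finiteness of the weighted sum over `k ≥ 1`. -/
def tailsL2 (w : ℕ → ℝ) : Set (ℕ → ℝ) :=
  {v | v ∈ tails ∧ SqSummable w v}

/-- The vector field `F = F₊ - F₋`, with values in the sequences vanishing at `0`. -/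
def field (α β : ℝ) (L : ℕ) (v : ℕ → ℝ) : ℕ → ℝ
  | 0 => 0
  | k + 1 => α * (v k ^ L - v (k + 1) ^ L) - β * (v (k + 1) - v (k + 2))

/-- `u` restricted to `[0, ∞)` is a solution with values in `𝒱` of
`u̇_t(k) = α (u_t(k-1)^L - u_t(k)^L) - β (u_t(k) - u_t(k+1))`, `k ≥ 1`
(with the right derivative at `t = 0`). -/
structure IsSolution (α β : ℝ) (L : ℕ) (u : ℝ → ℕ → ℝ) : Prop where
  mem : ∀ t, 0 ≤ t → u t ∈ tails
  deriv : ∀ t, 0 ≤ t → ∀ k, 1 ≤ k →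
    HasDerivWithinAt (fun s => u s k) (field α β L (u t) k) (Set.Ici 0) t

/-- The stable point `ũ(k) = ρ^{L^{k-1} + ⋯ + L + 1}` (so `ũ(0) = 1`), where `ρ = α / β`. -/
noncomputable def stablePoint (α β : ℝ) (L : ℕ) (k : ℕ) : ℝ :=
  (α / β) ^ (∑ i ∈ Finset.range k, L ^ i)

end LoadBalancing

/-! Write `z k = |u t k - ũ k|` for the deviation from the stable point `ũ`. Since `α ũ(k)^L = β
ũ(k+1)`, replacing differences of `L`-th powers by divided differences makes the equation for `u -
ũ` exactly linear. Kato's inequality passes to `z`, and the fluxes telescope in the tail sums `Z k =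
∑_{k ≤ j ≤ N} z j`. These satisfy a birth-death differential inequality with death rate `β` and
birth rates `α (1 + L ρ^k)`, zero at `k = 0`, up to the flux `β z (N+1)` through the cut-off. The
rates depend on `u` only through `0 ≤ u ≤ 1`, so the constants are uniform over initial states
(`powSlope_le`, `IsSolution.exists_deriv_deviationTail`).

As `∑ ρ^k` converges, the rates are a mild perturbation of the constant rates `α < β`. Explicit
supersolutions `φ` of order `θ^(k/2)` for the operator and `ψ` of order `θ^(-k/2)` for its adjoint
(`exists_supersolutions`) make the quadratic form with weight `ψ/φ`, comparable to `θ^(-k)`, decay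
at rate `2κ` (`sum_weighted_birthDeath_le`).

Hardy's inequality (`sum_sq_tail_le`) bounds the norm of `Z` by that of `z`, and `z ≤ Z` gives the
converse. The a priori bound `IsSolution.weighted_sq_le` makes the flux error vanish as `N → ∞`. -/

namespace LoadBalancing

open Filter Topology

/-! ### Quadratic Lyapunov weights for birth-death operators -/

/-- Summation by parts for a birth-death operator with birth rates `A` and death rate `β`. -/
theorem sum_mul_birthDeath (A ψ ζ : ℕ → ℝ) (β : ℝ) (N : ℕ) :
    ∑ k ∈ Finset.range N,
        ψ (k + 1) * (A k * (ζ k - ζ (k + 1)) - β * (ζ (k + 1) - ζ (k + 2))) =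
      ∑ k ∈ Finset.range N,
        ζ (k + 1) * (A (k + 1) * ψ (k + 2) - (A k + β) * ψ (k + 1) + β * ψ k) +
      (A 0 * ψ 1 * ζ 0 - A N * ψ (N + 1) * ζ N) + β * (ψ N * ζ (N + 1) - ψ 0 * ζ 1) := by
  induction N with
  | zero => simp
  | succ n ih =>
    rw [Finset.sum_range_succ, Finset.sum_range_succ, ih]
    ring

/-- The gap is a perfect square over `p * q`. With `p`, `q` neighbouring values of `φ`, this
decouples the cross terms of the quadratic form. -/
theorem two_mul_le_of_pos {a b p q : ℝ} (hp : 0 < p) (hq : 0 < q) :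
    2 * a * b ≤ a ^ 2 * (q / p) + b ^ 2 * (p / q) := by
  have h : a ^ 2 * (q / p) + b ^ 2 * (p / q) - 2 * a * b = (a * q - b * p) ^ 2 / (p * q) := by
    field_simp
    ring
  have : 0 ≤ (a * q - b * p) ^ 2 / (p * q) := by positivity
  linarith

/-- If `φ` is a supersolution for the birth-death operator and `ψ` one for its adjoint, then the
operator is dissipative for the quadratic form with weight `ψ / φ`. -/
theorem sum_weighted_birthDeath_le {A φ ψ Z : ℕ → ℝ} {β κ : ℝ} {N : ℕ}
    (hβ : 0 ≤ β) (hA : ∀ k, 0 ≤ A k) (hA0 : A 0 = 0)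
    (hφ : ∀ k, 0 < φ k) (hψ0 : ψ 0 = 0) (hψ : ∀ k, 0 < ψ (k + 1))
    (hGφ : ∀ k, A k * (φ k - φ (k + 1)) - β * (φ (k + 1) - φ (k + 2)) ≤ -κ * φ (k + 1))
    (hGψ : ∀ k, A (k + 1) * ψ (k + 2) - (A k + β) * ψ (k + 1) + β * ψ k ≤ -κ * ψ (k + 1))
    (hZ : Z (N + 1) = 0) :
    ∑ k ∈ Finset.range N, ψ (k + 1) / φ (k + 1) *
        (2 * Z (k + 1) * (A k * (Z k - Z (k + 1)) - β * (Z (k + 1) - Z (k + 2)))) ≤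
      -(2 * κ) * ∑ k ∈ Finset.range N, ψ (k + 1) / φ (k + 1) * Z (k + 1) ^ 2 := by
  -- Young's inequality on the cross terms and the supersolution `φ` give one `-κ`, leaving the
  -- operator applied to `ζ`. Summation by parts moves it onto `ψ`, which gives the other `-κ`.
  set ζ : ℕ → ℝ := fun k => Z k ^ 2 / φ k with hζ
  have hζ0 : ∀ k, 0 ≤ ζ k := fun k => div_nonneg (sq_nonneg _) (hφ k).le
  have hpt : ∀ k, ψ (k + 1) / φ (k + 1) *
      (2 * Z (k + 1) * (A k * (Z k - Z (k + 1)) - β * (Z (k + 1) - Z (k + 2)))) ≤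
      -κ * (ψ (k + 1) / φ (k + 1) * Z (k + 1) ^ 2) +
      ψ (k + 1) * (A k * (ζ k - ζ (k + 1)) - β * (ζ (k + 1) - ζ (k + 2))) := by
    intro k
    have h0 := hφ k
    have h1 := hφ (k + 1)
    have h2 := hφ (k + 2)
    have e1 := mul_le_mul_of_nonneg_left
      (two_mul_le_of_pos (a := Z (k + 1)) (b := Z k) h1 h0) (hA k)
    have e2 := mul_le_mul_of_nonneg_left
      (two_mul_le_of_pos (a := Z (k + 1)) (b := Z (k + 2)) h1 h2) hβ
    have e3 := mul_le_mul_of_nonneg_left (hGφ k)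
      (div_nonneg (sq_nonneg (Z (k + 1))) h1.le)
    have e4 : 2 * Z (k + 1) * (A k * (Z k - Z (k + 1)) - β * (Z (k + 1) - Z (k + 2))) ≤
        -κ * Z (k + 1) ^ 2 +
          φ (k + 1) * (A k * (ζ k - ζ (k + 1)) - β * (ζ (k + 1) - ζ (k + 2))) := by
      have i1 : φ (k + 1) * (A k * (ζ k - ζ (k + 1)) - β * (ζ (k + 1) - ζ (k + 2))) =
          A k * (Z (k + 1) ^ 2 * (φ k / φ (k + 1)) + Z k ^ 2 * (φ (k + 1) / φ k)) +
          β * (Z (k + 1) ^ 2 * (φ (k + 2) / φ (k + 1)) +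
            Z (k + 2) ^ 2 * (φ (k + 1) / φ (k + 2))) -
          2 * (A k + β) * Z (k + 1) ^ 2 -
          Z (k + 1) ^ 2 / φ (k + 1) *
            (A k * (φ k - φ (k + 1)) - β * (φ (k + 1) - φ (k + 2))) := by
        simp only [hζ]
        field_simp
        ring
      have i2 : Z (k + 1) ^ 2 / φ (k + 1) * (-κ * φ (k + 1)) = -κ * Z (k + 1) ^ 2 := by
        field_simp
      rw [i1]
      linarith
    have e5 := mul_le_mul_of_nonneg_left e4 (div_pos (hψ k) h1).le
    refine e5.trans (le_of_eq ?_)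
    field_simp
  have hsum := Finset.sum_le_sum fun k (_ : k ∈ Finset.range N) => hpt k
  rw [Finset.sum_add_distrib, ← Finset.mul_sum, sum_mul_birthDeath, hA0, hψ0] at hsum
  have hζN : ζ (N + 1) = 0 := by simp [hζ, hZ]
  rw [hζN] at hsum
  have hbd : 0 ≤ A N * ψ (N + 1) * ζ N := mul_nonneg (mul_nonneg (hA N) (hψ N).le) (hζ0 N)
  have hG : ∑ k ∈ Finset.range N,
      ζ (k + 1) * (A (k + 1) * ψ (k + 2) - (A k + β) * ψ (k + 1) + β * ψ k) ≤
      -κ * ∑ k ∈ Finset.range N, ψ (k + 1) / φ (k + 1) * Z (k + 1) ^ 2 := by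
    rw [Finset.mul_sum]
    refine Finset.sum_le_sum fun k _ => ?_
    refine (mul_le_mul_of_nonneg_left (hGψ k) (hζ0 _)).trans (le_of_eq ?_)
    simp only [hζ]
    ring
  linarith

/-! ### Explicit supersolutions -/

/-- Birth rates dominating those of the linearised dynamics. -/
noncomputable def birthRate (α ρ : ℝ) (L k : ℕ) : ℝ :=
  if k = 0 then 0 else α * (1 + L * ρ ^ k)

theorem birthRate_nonneg {α ρ : ℝ} (hα : 0 ≤ α) (hρ : 0 ≤ ρ) (L k : ℕ) :
    0 ≤ birthRate α ρ L k := by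
  unfold birthRate
  split_ifs <;> positivity

/-- The product `∏_{i < k} (1 + L ρ ^ i)`. -/
noncomputable def rateProd (ρ : ℝ) (L k : ℕ) : ℝ := ∏ i ∈ Finset.range k, (1 + L * ρ ^ i)

theorem rateProd_succ (ρ : ℝ) (L k : ℕ) :
    rateProd ρ L (k + 1) = rateProd ρ L k * (1 + L * ρ ^ k) :=
  Finset.prod_range_succ _ _

theorem one_le_rateProd {ρ : ℝ} (hρ : 0 ≤ ρ) (L k : ℕ) : 1 ≤ rateProd ρ L k := by
  induction k with
  | zero => simp [rateProd]
  | succ n ih =>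
    rw [rateProd_succ]
    have : (0 : ℝ) ≤ L * ρ ^ n := by positivity
    exact one_le_mul_of_one_le_of_one_le ih (by linarith)

/-- Follows from `1 + x ≤ exp x` and the geometric series. Uniformity in `k` keeps the weights
comparable to pure powers, whatever `L` is. -/
theorem rateProd_le {ρ : ℝ} (hρ : 0 ≤ ρ) (hρ1 : ρ < 1) (L k : ℕ) :
    rateProd ρ L k ≤ Real.exp (L * (1 - ρ)⁻¹) := by
  have h1 : rateProd ρ L k ≤ ∏ i ∈ Finset.range k, Real.exp (L * ρ ^ i) := by
    refine Finset.prod_le_prod (fun i _ => by positivity) fun i _ => ?_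
    rw [add_comm]
    exact Real.add_one_le_exp _
  refine h1.trans ?_
  rw [← Real.exp_sum, ← Finset.mul_sum]
  refine Real.exp_le_exp.2 (mul_le_mul_of_nonneg_left ?_ (by positivity))
  rw [← tsum_geometric_of_lt_one hρ hρ1]
  exact (summable_geometric_of_lt_one hρ hρ1).sum_le_tsum _ fun i _ => by positivity

/-- The discounted tail sum `∑_j q ^ j p (k + j)`. -/
noncomputable def discountedTail (p : ℕ → ℝ) (q : ℝ) (k : ℕ) : ℝ := ∑' j, q ^ j * p (k + j)

section discountedTail

variable {p : ℕ → ℝ} {q P : ℝ}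

theorem summable_discountedTail (hq : 0 ≤ q) (hq1 : q < 1) (hp : ∀ k, 1 ≤ p k)
    (hP : ∀ k, p k ≤ P) (k : ℕ) : Summable fun j => q ^ j * p (k + j) := by
  refine Summable.of_nonneg_of_le (fun j => ?_) (fun j => ?_)
    ((summable_geometric_of_lt_one hq hq1).mul_right P)
  · have := hp (k + j)
    positivity
  · exact mul_le_mul_of_nonneg_left (hP _) (by positivity)

theorem discountedTail_eq (hq : 0 ≤ q) (hq1 : q < 1) (hp : ∀ k, 1 ≤ p k)
    (hP : ∀ k, p k ≤ P) (k : ℕ) :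
    discountedTail p q k = p k + q * discountedTail p q (k + 1) := by
  unfold discountedTail
  rw [(summable_discountedTail hq hq1 hp hP k).tsum_eq_zero_add, ← tsum_mul_left]
  congr 1
  · simp
  · refine tsum_congr fun j => ?_
    rw [show k + 1 + j = k + (j + 1) by ring]
    ring

theorem discountedTail_le (hq : 0 ≤ q) (hq1 : q < 1) (hp : ∀ k, 1 ≤ p k)
    (hP : ∀ k, p k ≤ P) (k : ℕ) : discountedTail p q k ≤ P / (1 - q) := by
  unfold discountedTail
  rw [div_eq_inv_mul, ← tsum_geometric_of_lt_one hq hq1, ← tsum_mul_right]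
  exact (summable_discountedTail hq hq1 hp hP k).tsum_le_tsum
    (fun j => mul_le_mul_of_nonneg_left (hP _) (by positivity))
    ((summable_geometric_of_lt_one hq hq1).mul_right P)

theorem discountedTail_nonneg (hq : 0 ≤ q) (hp : ∀ k, 1 ≤ p k) (k : ℕ) :
    0 ≤ discountedTail p q k :=
  tsum_nonneg fun j => by
    have := hp (k + j)
    positivity

theorem le_discountedTail (hq : 0 ≤ q) (hq1 : q < 1) (hp : ∀ k, 1 ≤ p k)
    (hP : ∀ k, p k ≤ P) (k : ℕ) : p k ≤ discountedTail p q k := by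
  rw [discountedTail_eq hq hq1 hp hP]
  have := mul_nonneg hq (discountedTail_nonneg hq hp (k + 1))
  linarith

end discountedTail

/-- Supersolutions for the dominating birth-death operator and its adjoint, whose ratio is
equivalent to the weight `θ⁻ᵏ`. -/
theorem exists_supersolutions {α β θ : ℝ} (hα : 0 < α) (hβ : 0 < β) (L : ℕ)
    (hρθ : α / β ≤ θ) (hθ : θ < 1) :
    ∃ κ : ℝ, 0 < κ ∧ ∃ K : ℝ, 0 < K ∧ ∃ φ ψ : ℕ → ℝ,
      (∀ k, 0 < φ k) ∧ ψ 0 = 0 ∧ (∀ k, 0 < ψ (k + 1)) ∧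
      (∀ k, birthRate α (α / β) L k * (φ k - φ (k + 1)) - β * (φ (k + 1) - φ (k + 2)) ≤
        -κ * φ (k + 1)) ∧
      (∀ k, birthRate α (α / β) L (k + 1) * ψ (k + 2) -
        (birthRate α (α / β) L k + β) * ψ (k + 1) + β * ψ k ≤ -κ * ψ (k + 1)) ∧
      (∀ k, (θ ^ (k + 1))⁻¹ ≤ K * (ψ (k + 1) / φ (k + 1))) ∧
      (∀ k, ψ (k + 1) / φ (k + 1) ≤ K * (θ ^ (k + 1))⁻¹) := by
  set ρ := α / β with hρdef
  have hρ : 0 < ρ := div_pos hα hβ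
  have hαρ : α = β * ρ := by rw [hρdef]; field_simp
  have hθ0 : 0 < θ := hρ.trans_le hρθ
  have hρ1 : ρ < 1 := hρθ.trans_lt hθ
  -- `φ` and `1/ψ` will both have order `r ^ k`. The condition `ρ ≤ θ` becomes `q = ρ / r ≤ r`, so
  -- the endpoint `θ = ρ` is allowed.
  set r := Real.sqrt θ with hr
  have hr0 : 0 < r := Real.sqrt_pos.2 hθ0
  have hrr : r ^ 2 = θ := Real.sq_sqrt hθ0.le
  have hr1 : r < 1 := by nlinarith
  have hρr : ρ < r := by nlinarith
  set q := ρ / r with hq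
  have hq0 : 0 < q := div_pos hρ hr0
  have hqr : q ≤ r := by rw [hq, div_le_iff₀ hr0]; nlinarith
  have hq1 : q < 1 := hqr.trans_lt hr1
  set P := Real.exp (L * (1 - ρ)⁻¹) with hP
  set p := rateProd ρ L with hpdef
  have hp1 : ∀ k, 1 ≤ p k := one_le_rateProd hρ.le L
  have hpP : ∀ k, p k ≤ P := rateProd_le hρ.le hρ1 L
  have hps : ∀ k, p (k + 1) = p k * (1 + L * ρ ^ k) := rateProd_succ ρ L
  have hP0 : 0 < P := Real.exp_pos _
  set T := discountedTail p r with hT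
  set S := discountedTail p q with hS
  have hTe : ∀ k, T k = p k + r * T (k + 1) := discountedTail_eq hr0.le hr1 hp1 hpP
  have hSe : ∀ k, S k = p k + q * S (k + 1) := discountedTail_eq hq0.le hq1 hp1 hpP
  have hTl : ∀ k, p k ≤ T k := le_discountedTail hr0.le hr1 hp1 hpP
  have hSl : ∀ k, p k ≤ S k := le_discountedTail hq0.le hq1 hp1 hpP
  have h1r : 0 < 1 - r := by linarith
  have hTu : ∀ k, T k ≤ P / (1 - r) := discountedTail_le hr0.le hr1 hp1 hpP
  have hSu : ∀ k, S k ≤ P / (1 - r) := fun k =>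
    (discountedTail_le hq0.le hq1 hp1 hpP k).trans
      (div_le_div_of_nonneg_left hP0.le h1r (by linarith))
  have hp0 : ∀ k, 0 < p k := fun k => by linarith [hp1 k]
  have hT0 : ∀ k, 0 < T k := fun k => (hp0 k).trans_le (hTl k)
  have hS0 : ∀ k, 0 < S k := fun k => (hp0 k).trans_le (hSl k)
  -- Both are chosen to have explicit first-order differences (`hφd`, `hχd`): `φ` sums `r ^ j * p j`
  -- over `j ≥ k`, and the factors of `p` absorb `1 + L ρ^k`.
  set φ : ℕ → ℝ := fun k => r ^ k * T k with hφdef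
  set χ : ℕ → ℝ := fun k => (r ^ k)⁻¹ * (S k / p k) with hχdef
  have hφd : ∀ k, φ k - φ (k + 1) = r ^ k * p k := fun k => by
    simp only [hφdef]; rw [hTe k]; ring
  have hχd : ∀ k, β * χ k - α * (1 + L * ρ ^ k) * χ (k + 1) = β * (r ^ k)⁻¹ := fun k => by
    have hc : (0 : ℝ) < 1 + L * ρ ^ k := by positivity
    have := hp0 k
    simp only [hχdef]
    rw [hSe k, hps k, hαρ, hq]
    field_simp
    ring
  have hφ0 : ∀ k, 0 < φ k := fun k => mul_pos (pow_pos hr0 k) (hT0 k)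
  have hχ0 : ∀ k, 0 < χ k := fun k =>
    mul_pos (inv_pos.2 (pow_pos hr0 k)) (div_pos (hS0 k) (hp0 k))
  have hχu : ∀ k, χ k ≤ (r ^ k)⁻¹ * (P / (1 - r)) := fun k =>
    mul_le_mul_of_nonneg_left
      ((div_le_self (hS0 k).le (hp1 k)).trans (hSu k)) (inv_pos.2 (pow_pos hr0 k)).le
  have hχl : ∀ k, (r ^ k)⁻¹ ≤ χ k := fun k =>
    le_mul_of_one_le_right (inv_pos.2 (pow_pos hr0 k)).le ((one_le_div (hp0 k)).2 (hSl k))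
  have hφu : ∀ k, φ k ≤ r ^ k * (P / (1 - r)) := fun k =>
    mul_le_mul_of_nonneg_left (hTu k) (pow_pos hr0 k).le
  have hφl : ∀ k, r ^ k ≤ φ k := fun k =>
    le_mul_of_one_le_right (pow_pos hr0 k).le ((hp1 k).trans (hTl k))
  -- The two entries are the margins for `φ`, from `ρ < r`, and for `ψ`, from `r < 1`, divided by
  -- the upper bound `P / (1 - r)`.
  set κ := min ((β * (r - ρ)) * (1 - r) / P) (β * (1 - r) * (1 - r) / P) with hκ
  have hκ0 : 0 < κ := by
    have : 0 < r - ρ := by linarith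
    exact lt_min (by positivity) (by positivity)
  have hκ1 : κ * (P / (1 - r)) ≤ β * (r - ρ) := by
    refine (mul_le_mul_of_nonneg_right (min_le_left _ _) (by positivity)).trans (le_of_eq ?_)
    field_simp
  have hκ2 : κ * (P / (1 - r)) ≤ β * (1 - r) := by
    refine (mul_le_mul_of_nonneg_right (min_le_right _ _) (by positivity)).trans (le_of_eq ?_)
    field_simp
  have hθr : ∀ k, (θ ^ k)⁻¹ = (r ^ k)⁻¹ / r ^ k := fun k => by
    rw [← hrr, ← pow_mul, mul_comm 2 k, pow_mul]
    have := pow_pos hr0 k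
    field_simp
  set ψ : ℕ → ℝ := fun k => if k = 0 then 0 else χ k with hψdef
  have hψs : ∀ k, ψ (k + 1) = χ (k + 1) := fun k => by simp [hψdef]
  have hPr : 0 < P / (1 - r) := by positivity
  refine ⟨κ, hκ0, P / (1 - r), hPr, φ, ψ, hφ0, by simp [hψdef],
    fun k => by rw [hψs]; exact hχ0 _, fun k => ?_, fun k => ?_, fun k => ?_, fun k => ?_⟩
  · rw [hφd, hφd]
    have hrk := pow_pos hr0 k
    have hA : birthRate α ρ L k ≤ α * (1 + L * ρ ^ k) := by
      unfold birthRate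
      split_ifs
      · positivity
      · exact le_rfl
    have h1 := mul_le_mul_of_nonneg_right hA (mul_pos hrk (hp0 k)).le
    have h2 : α * (1 + L * ρ ^ k) * (r ^ k * p k) - β * (r ^ (k + 1) * p (k + 1)) =
        -(β * (r - ρ)) * (r ^ k * p (k + 1)) := by
      rw [hps, hαρ]; ring
    have h3 : κ * φ (k + 1) ≤ β * (r - ρ) * (r ^ k * p (k + 1)) := by
      calc κ * φ (k + 1) ≤ κ * (r ^ (k + 1) * (P / (1 - r))) :=
            mul_le_mul_of_nonneg_left (hφu _) hκ0.le
        _ = κ * (P / (1 - r)) * r ^ (k + 1) := by ring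
        _ ≤ β * (r - ρ) * r ^ (k + 1) := mul_le_mul_of_nonneg_right hκ1 (by positivity)
        _ ≤ β * (r - ρ) * (r ^ k * p (k + 1)) := by
            refine mul_le_mul_of_nonneg_left ?_ (by nlinarith)
            rw [pow_succ]
            exact mul_le_mul_of_nonneg_left (hr1.le.trans (hp1 _)) hrk.le
    linarith
  · rw [hψs, hψs]
    have e1 : birthRate α ρ L (k + 1) = α * (1 + L * ρ ^ (k + 1)) := by simp [birthRate]
    have e2 := hχd (k + 1)
    have e3 : β * ψ k - birthRate α ρ L k * χ (k + 1) ≤ β * (r ^ k)⁻¹ := by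
      by_cases hk : k = 0
      · subst hk
        simp [hψdef, birthRate, hβ.le]
      · simp only [hψdef, birthRate, if_neg hk]
        exact (hχd k).le
    have e4 : (r ^ k)⁻¹ = (r ^ (k + 1))⁻¹ * r := by
      rw [pow_succ]
      field_simp
    have e5 : κ * χ (k + 1) ≤ β * (1 - r) * (r ^ (k + 1))⁻¹ := by
      calc κ * χ (k + 1) ≤ κ * ((r ^ (k + 1))⁻¹ * (P / (1 - r))) :=
            mul_le_mul_of_nonneg_left (hχu _) hκ0.le
        _ = κ * (P / (1 - r)) * (r ^ (k + 1))⁻¹ := by ring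
        _ ≤ _ := mul_le_mul_of_nonneg_right hκ2 (by positivity)
    rw [e4] at e3
    rw [e1]
    linarith
  · rw [hψs, hθr, ← mul_div_assoc, div_le_div_iff₀ (by positivity) (hφ0 _)]
    have := mul_le_mul (hχl (k + 1)) (hφu (k + 1)) (hφ0 _).le (hχ0 _).le
    linarith
  · rw [hψs, hθr, ← mul_div_assoc]
    have h := hχu (k + 1)
    rw [mul_comm (P / (1 - r))]
    exact div_le_div₀ (by positivity) h (by positivity) (hφl _)

/-- A weighted Hardy inequality for finite sequences. -/
theorem sum_sq_tail_le {θ : ℝ} (hθ0 : 0 < θ) (hθ : θ < 1) (z : ℕ → ℝ) (N : ℕ) :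
    ∑ k ∈ Finset.range N, (∑ j ∈ Finset.Ico (k + 1) (N + 1), z j) ^ 2 * (θ ^ (k + 1))⁻¹ ≤
      ((1 - Real.sqrt θ) ^ 2)⁻¹ * ∑ k ∈ Finset.range N, z (k + 1) ^ 2 * (θ ^ (k + 1))⁻¹ := by
  set r := Real.sqrt θ with hr
  have hr0 : 0 < r := Real.sqrt_pos.2 hθ0
  have hrr : r ^ 2 = θ := Real.sq_sqrt hθ0.le
  have hr1 : r < 1 := by nlinarith
  have h1r : 0 < 1 - r := by linarith
  set Z : ℕ → ℝ := fun k => ∑ j ∈ Finset.Ico (k + 1) (N + 1), z j with hZ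
  set f : ℕ → ℝ := fun k => Z k ^ 2 * (θ ^ (k + 1))⁻¹ with hf
  have hfN : f N = 0 := by simp [hf, hZ]
  have hf0 : ∀ k, 0 ≤ f k := fun k => by simp only [hf]; positivity
  have hpt : ∀ k ∈ Finset.range N,
      f k ≤ r * f (k + 1) + (1 - r)⁻¹ * (z (k + 1) ^ 2 * (θ ^ (k + 1))⁻¹) := by
    intro k hk
    have hkN := Finset.mem_range.1 hk
    have hs : Z k = z (k + 1) + Z (k + 1) := by
      simp only [hZ]
      rw [Finset.sum_eq_sum_Ico_succ_bot (by omega)]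
    -- Young's inequality with proportions `r` and `1 - r`: as `r ^ 2 = θ`, the shift of weight
    -- turns `r⁻¹` into the contraction factor `r`.
    have hsq : Z k ^ 2 ≤ r⁻¹ * Z (k + 1) ^ 2 + (1 - r)⁻¹ * z (k + 1) ^ 2 := by
      rw [hs]
      have : r⁻¹ * Z (k + 1) ^ 2 + (1 - r)⁻¹ * z (k + 1) ^ 2 - (z (k + 1) + Z (k + 1)) ^ 2 =
          ((1 - r) * Z (k + 1) - r * z (k + 1)) ^ 2 / (r * (1 - r)) := by
        field_simp
        ring
      have h0 : 0 ≤ ((1 - r) * Z (k + 1) - r * z (k + 1)) ^ 2 / (r * (1 - r)) := by positivity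
      linarith
    refine (mul_le_mul_of_nonneg_right hsq (by positivity)).trans (le_of_eq ?_)
    simp only [hf]
    rw [pow_succ θ (k + 1), ← hrr]
    field_simp
  have hsum := Finset.sum_le_sum hpt
  rw [Finset.sum_add_distrib, ← Finset.mul_sum, ← Finset.mul_sum] at hsum
  have hshift : ∑ k ∈ Finset.range N, f (k + 1) ≤ ∑ k ∈ Finset.range N, f k := by
    have h1 := Finset.sum_range_succ f N
    have h2 := Finset.sum_range_succ' f N
    have := hf0 0
    linarith
  have h3 := mul_le_mul_of_nonneg_left hshift hr0.le
  have h4 : (1 - r) * ∑ k ∈ Finset.range N, f k ≤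
      (1 - r)⁻¹ * ∑ k ∈ Finset.range N, z (k + 1) ^ 2 * (θ ^ (k + 1))⁻¹ := by linarith
  have h5 := mul_le_mul_of_nonneg_left h4 (inv_pos.2 h1r).le
  rw [inv_mul_cancel_left₀ h1r.ne', ← mul_assoc, ← mul_inv, ← sq] at h5
  exact h5

/-! ### Right derivatives and differential inequalities -/

/-- At a zero of `f`, the right slopes of `|f|` are the absolute values of those of `f`; a two-sided
derivative need not exist. -/
theorem hasDerivWithinAt_abs_of_eq_zero {f : ℝ → ℝ} {f' t : ℝ}
    (hf : HasDerivWithinAt f f' (Set.Ici t) t) (h0 : f t = 0) :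
    HasDerivWithinAt (fun s => |f s|) |f'| (Set.Ici t) t := by
  rw [hasDerivWithinAt_iff_tendsto_slope] at hf ⊢
  refine hf.abs.congr' ?_
  filter_upwards [self_mem_nhdsWithin] with s hs
  have hts : 0 < s - t := by
    have h1 : t ≤ s := hs.1
    have h2 : s ≠ t := hs.2
    exact sub_pos.2 (lt_of_le_of_ne h1 h2.symm)
  simp [slope_def_field, h0, abs_div, abs_of_pos hts]

/-- Kato's inequality for right derivatives. -/
theorem exists_hasDerivWithinAt_abs_le {f : ℝ → ℝ} {f' t b e e' : ℝ}
    (hf : HasDerivWithinAt f f' (Set.Ici t) t) (h : f' = -b * f t + e) (he : |e| ≤ e') :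
    ∃ d, HasDerivWithinAt (fun s => |f s|) d (Set.Ici t) t ∧ d ≤ -b * |f t| + e' := by
  rcases lt_trichotomy (f t) 0 with hneg | h0 | hpos
  · refine ⟨-f', hf.neg.congr_of_eventuallyEq ?_ (abs_of_neg hneg), ?_⟩
    · filter_upwards [hf.continuousWithinAt.eventually_lt_const hneg] with s hs
      exact abs_of_neg hs
    · rw [abs_of_neg hneg, h]
      linarith [(abs_le.1 he).1]
  · refine ⟨|f'|, hasDerivWithinAt_abs_of_eq_zero hf h0, ?_⟩
    rw [h, h0]
    simpa using he
  · refine ⟨f', hf.congr_of_eventuallyEq ?_ (abs_of_pos hpos), ?_⟩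
    · filter_upwards [hf.continuousWithinAt.eventually_const_lt hpos] with s hs
      exact abs_of_pos hs
    · rw [abs_of_pos hpos, h]
      linarith [(abs_le.1 he).2]

/-- Grönwall's inequality in integrated form, for right derivatives. -/
theorem exp_mul_le_of_deriv_right_le {E ε : ℝ → ℝ} {c T : ℝ} (hT : 0 ≤ T)
    (hE : ContinuousOn E (Set.Icc 0 T)) (hε : Continuous ε)
    (hd : ∀ t ∈ Set.Ico 0 T, ∃ d, HasDerivWithinAt E d (Set.Ici t) t ∧ d ≤ -c * E t + ε t) :
    Real.exp (c * T) * E T ≤ E 0 + ∫ s in (0 : ℝ)..T, Real.exp (c * s) * ε s := by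
  choose! d hd hle using hd
  have hexp : ∀ t, HasDerivAt (fun s => Real.exp (c * s)) (Real.exp (c * t) * c) t := fun t => by
    simpa using ((hasDerivAt_id t).const_mul c).exp
  have hcont : Continuous fun s => Real.exp (c * s) * ε s := by fun_prop
  refine image_le_of_deriv_right_le_deriv_boundary (a := 0) (b := T)
    (f := fun t => Real.exp (c * t) * E t)
    (f' := fun t => Real.exp (c * t) * c * E t + Real.exp (c * t) * d t)
    (B := fun t => E 0 + ∫ s in (0 : ℝ)..t, Real.exp (c * s) * ε s)
    (B' := fun t => Real.exp (c * t) * ε t) ?_ ?_ ?_ ?_ ?_ ?_ (Set.right_mem_Icc.2 hT)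
  · exact ContinuousOn.mul (by fun_prop) hE
  · exact fun t ht => (hexp t).hasDerivWithinAt.mul (hd t ht)
  · simp
  · exact (continuous_const.add
      (intervalIntegral.continuous_primitive (fun a b => hcont.intervalIntegrable a b) 0)).continuousOn
  · intro t _
    exact ((hcont.integral_hasStrictDerivAt 0 t).hasDerivAt.const_add _).hasDerivWithinAt
  · intro t ht
    have := mul_le_mul_of_nonneg_left (hle t ht) (Real.exp_pos (c * t)).le
    linarith

/-! ### The stable point and elementary properties of solutions -/

theorem stablePoint_zero (α β : ℝ) (L : ℕ) : stablePoint α β L 0 = 1 := by simp [stablePoint]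

/-- This is the balance of fluxes `α ũ(k)^L = β ũ(k+1)` that makes `ũ` stationary. -/
theorem stablePoint_succ (α β : ℝ) (L k : ℕ) :
    stablePoint α β L (k + 1) = α / β * stablePoint α β L k ^ L := by
  rw [stablePoint, stablePoint, geom_sum_succ, pow_succ, mul_comm, ← pow_mul, mul_comm L]

theorem stablePoint_pos {α β : ℝ} (hα : 0 < α) (hβ : 0 < β) (L k : ℕ) :
    0 < stablePoint α β L k := pow_pos (div_pos hα hβ) _

theorem stablePoint_le_pow {α β : ℝ} (hα : 0 < α) (hβ : 0 < β) (hρ : α / β ≤ 1) {L : ℕ}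
    (hL : 1 ≤ L) (k : ℕ) : stablePoint α β L k ≤ (α / β) ^ k := by
  refine pow_le_pow_of_le_one (div_pos hα hβ).le hρ ?_
  calc k = ∑ _i ∈ Finset.range k, 1 := by simp
    _ ≤ _ := Finset.sum_le_sum fun i _ => Nat.one_le_pow _ _ hL

theorem tails_nonneg {v : ℕ → ℝ} (hv : v ∈ tails) (k : ℕ) : 0 ≤ v k :=
  (antitone_nat_of_succ_le hv.2.1).le_of_tendsto hv.2.2 k

theorem tails_le_one {v : ℕ → ℝ} (hv : v ∈ tails) (k : ℕ) : v k ≤ 1 :=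
  hv.1 ▸ antitone_nat_of_succ_le hv.2.1 (Nat.zero_le k)

/-- The divided difference of `x ↦ x ^ L`. -/
noncomputable def powSlope (L : ℕ) (x y : ℝ) : ℝ :=
  ∑ i ∈ Finset.range L, x ^ i * y ^ (L - 1 - i)

theorem powSlope_mul (L : ℕ) (x y : ℝ) : powSlope L x y * (x - y) = x ^ L - y ^ L :=
  (Commute.all x y).geom_sum₂_mul L

theorem powSlope_nonneg {x y : ℝ} (hx : 0 ≤ x) (hy : 0 ≤ y) (L : ℕ) : 0 ≤ powSlope L x y :=
  Finset.sum_nonneg fun i _ => by positivity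

/-- Every term except `x ^ (L - 1)` contains a factor `y`. With `y = ũ(k)` the excess over `1` is
geometrically small in `k`, uniformly in `x`. -/
theorem powSlope_le {x y : ℝ} (hx : 0 ≤ x) (hx1 : x ≤ 1) (hy : 0 ≤ y) (hy1 : y ≤ 1) {L : ℕ}
    (hL : 1 ≤ L) : powSlope L x y ≤ 1 + L * y := by
  obtain ⟨n, rfl⟩ : ∃ n, L = n + 1 := ⟨L - 1, by omega⟩
  unfold powSlope
  rw [Finset.sum_range_succ, add_comm]
  have h1 : x ^ n * y ^ (n + 1 - 1 - n) ≤ 1 := by simpa using pow_le_one₀ hx hx1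
  have h2 : ∑ i ∈ Finset.range n, x ^ i * y ^ (n + 1 - 1 - i) ≤ ∑ i ∈ Finset.range n, y := by
    refine Finset.sum_le_sum fun i hi => ?_
    have hi := Finset.mem_range.1 hi
    calc x ^ i * y ^ (n + 1 - 1 - i) ≤ 1 * y ^ 1 :=
          mul_le_mul (pow_le_one₀ hx hx1) (pow_le_pow_of_le_one hy hy1 (by omega))
            (by positivity) zero_le_one
      _ = y := by ring
  rw [Finset.sum_const, Finset.card_range, nsmul_eq_mul] at h2
  rw [Nat.cast_succ]
  linarith

/-! ### A priori bounds and comparison with a linear birth-death equation -/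

section Solution

variable {α β θ : ℝ} {L : ℕ} {u : ℝ → ℕ → ℝ}

theorem IsSolution.continuousOn (hu : IsSolution α β L u) (k : ℕ) :
    ContinuousOn (fun t => u t k) (Set.Ici 0) := by
  rcases Nat.eq_zero_or_pos k with rfl | hk
  · exact (continuousOn_const (c := (1 : ℝ))).congr fun t ht => (hu.mem t ht).1
  · exact fun t ht => (hu.deriv t ht k hk).continuousWithinAt

/-- Clamping time at `0` gives integrands continuous on all of `ℝ`. -/
theorem IsSolution.continuous_max (hu : IsSolution α β L u) (k : ℕ) :
    Continuous fun t => u (max t 0) k :=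
  (hu.continuousOn k).comp_continuous (by fun_prop) fun _ => Set.mem_Ici.2 (le_max_right _ _)

theorem IsSolution.hasDerivWithinAt (hu : IsSolution α β L u) {t : ℝ} (ht : 0 ≤ t) (k : ℕ) :
    HasDerivWithinAt (fun s => u s (k + 1))
      (α * (u t k ^ L - u t (k + 1) ^ L) - β * (u t (k + 1) - u t (k + 2))) (Set.Ici t) t :=
  (hu.deriv t ht (k + 1) (by omega)).mono (Set.Ici_subset_Ici.2 ht)

/-- Exponential a priori bound for the weighted square sums of a solution. -/
theorem IsSolution.weighted_sq_le (hu : IsSolution α β L u) (hα : 0 < α) (hβ : 0 < β)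
    (hL : 1 ≤ L) (hθ0 : 0 < θ) (N : ℕ) {T : ℝ} (hT : 0 ≤ T) :
    1 + ∑ k ∈ Finset.range N, u T (k + 1) ^ 2 * (θ ^ (k + 1))⁻¹ ≤
      Real.exp (2 * α / θ * T) *
        (1 + ∑ k ∈ Finset.range N, u 0 (k + 1) ^ 2 * (θ ^ (k + 1))⁻¹) := by
  -- The summand `1` is the `k = 0` term, needed because the incoming flux shifts the index by one.
  set E : ℝ → ℝ := fun t => 1 + ∑ k ∈ Finset.range N, u t (k + 1) ^ 2 * (θ ^ (k + 1))⁻¹ with hE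
  have hcont : ContinuousOn E (Set.Icc 0 T) := by
    refine continuousOn_const.add (continuousOn_finsetSum _ fun k _ => ?_)
    exact (((hu.continuousOn (k + 1)).mono Set.Icc_subset_Ici_self).pow 2).mul continuousOn_const
  have key := exp_mul_le_of_deriv_right_le (E := E) (ε := fun _ => 0) (c := -(2 * α / θ)) hT hcont
    continuous_const ?_
  · simp only [mul_zero, intervalIntegral.integral_zero, add_zero] at key
    have h := mul_le_mul_of_nonneg_left key (Real.exp_pos (2 * α / θ * T)).le
    rwa [← mul_assoc, ← Real.exp_add, neg_mul, add_neg_cancel, Real.exp_zero, one_mul] at h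
  · intro t ht
    have ht0 := ht.1
    have hv := hu.mem t ht0
    have h0 := tails_nonneg hv
    have h1 := tails_le_one hv
    refine ⟨_, (HasDerivWithinAt.fun_sum fun k _ =>
      (((hu.hasDerivWithinAt ht0 k).pow 2).mul_const (θ ^ (k + 1))⁻¹)).const_add 1, ?_⟩
    set g : ℕ → ℝ := fun k => u t k ^ 2 * (θ ^ k)⁻¹ with hg
    have hpt : ∀ k ∈ Finset.range N, ((2 : ℕ) : ℝ) * u t (k + 1) ^ (2 - 1) *
        (α * (u t k ^ L - u t (k + 1) ^ L) - β * (u t (k + 1) - u t (k + 2))) *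
        (θ ^ (k + 1))⁻¹ ≤ 2 * α / θ * g k := by
      intro k _
      have a1 : u t k ^ L ≤ u t k := pow_le_of_le_one (h0 k) (h1 k) (by omega)
      have a2 : 0 ≤ u t (k + 1) ^ L := pow_nonneg (h0 _) _
      have a3 : 0 ≤ β * (u t (k + 1) - u t (k + 2)) :=
        mul_nonneg hβ.le (sub_nonneg.2 (hv.2.1 (k + 1)))
      have a4 : α * (u t k ^ L - u t (k + 1) ^ L) - β * (u t (k + 1) - u t (k + 2)) ≤
          α * u t k := by nlinarith
      have a5 : u t (k + 1) * (α * u t k) ≤ u t k * (α * u t k) :=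
        mul_le_mul_of_nonneg_right (hv.2.1 k) (mul_nonneg hα.le (h0 k))
      have a6 := mul_le_mul_of_nonneg_left a4 (h0 (k + 1))
      have a7 : ((2 : ℕ) : ℝ) * u t (k + 1) ^ (2 - 1) *
          (α * (u t k ^ L - u t (k + 1) ^ L) - β * (u t (k + 1) - u t (k + 2))) ≤
          2 * α * u t k ^ 2 := by
        norm_num
        linarith
      refine (mul_le_mul_of_nonneg_right a7 (by positivity)).trans (le_of_eq ?_)
      simp only [hg, pow_succ]
      field_simp
    refine (Finset.sum_le_sum hpt).trans ?_
    rw [← Finset.mul_sum, neg_neg, add_zero]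
    refine mul_le_mul_of_nonneg_left ?_ (by positivity)
    have e1 := Finset.sum_range_succ g N
    have e2 := Finset.sum_range_succ' g N
    have e3 : g 0 = 1 := by simp [hg, hv.1]
    have e4 : 0 ≤ g N := by simp only [hg]; positivity
    have e5 : E t = 1 + ∑ k ∈ Finset.range N, g (k + 1) := rfl
    linarith

/-- Right derivatives of the absolute deviations from the stable point. -/
theorem IsSolution.exists_deriv_abs_sub (hu : IsSolution α β L u) (hα : 0 < α) (hβ : 0 < β)
    {t : ℝ} (ht : 0 ≤ t) (k : ℕ) :
    ∃ d, HasDerivWithinAt (fun s => |u s (k + 1) - stablePoint α β L (k + 1)|) d (Set.Ici t) t ∧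
      d ≤ (α * powSlope L (u t k) (stablePoint α β L k) * |u t k - stablePoint α β L k| -
          β * |u t (k + 1) - stablePoint α β L (k + 1)|) -
        (α * powSlope L (u t (k + 1)) (stablePoint α β L (k + 1)) *
            |u t (k + 1) - stablePoint α β L (k + 1)| -
          β * |u t (k + 2) - stablePoint α β L (k + 2)|) := by
  set v := stablePoint α β L with hv
  have h0 := tails_nonneg (hu.mem t ht)
  have hv0 : ∀ k, 0 ≤ v k := fun k => (stablePoint_pos hα hβ L k).le
  have hc : ∀ k, 0 ≤ powSlope L (u t k) (v k) := fun k => powSlope_nonneg (h0 k) (hv0 k) L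
  have hs : ∀ k, α * v k ^ L = β * v (k + 1) := fun k => by
    rw [hv, stablePoint_succ]
    field_simp
  -- Exact linearisation: divided differences replace the powers, and the balance of fluxes cancels
  -- the constant terms.
  have hlin : α * (u t k ^ L - u t (k + 1) ^ L) - β * (u t (k + 1) - u t (k + 2)) =
      -(α * powSlope L (u t (k + 1)) (v (k + 1)) + β) * (u t (k + 1) - v (k + 1)) +
        (α * powSlope L (u t k) (v k) * (u t k - v k) + β * (u t (k + 2) - v (k + 2))) := by
    have e1 := powSlope_mul L (u t k) (v k)
    have e2 := powSlope_mul L (u t (k + 1)) (v (k + 1))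
    have e3 := hs k
    have e4 := hs (k + 1)
    linear_combination (-α) * e1 + α * e2 + e3 - e4
  have habs : |α * powSlope L (u t k) (v k) * (u t k - v k) + β * (u t (k + 2) - v (k + 2))| ≤
      α * powSlope L (u t k) (v k) * |u t k - v k| + β * |u t (k + 2) - v (k + 2)| := by
    refine (abs_add_le _ _).trans (le_of_eq ?_)
    rw [abs_mul, abs_mul, abs_mul, abs_of_pos hα, abs_of_pos hβ, abs_of_nonneg (hc k)]
  obtain ⟨d, hd, hle⟩ := exists_hasDerivWithinAt_abs_le
    ((hu.hasDerivWithinAt ht k).sub_const (v (k + 1))) hlin habs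
  refine ⟨d, hd, hle.trans (le_of_eq ?_)⟩
  ring

/-- The absolute deviation from the stable point, summed over the sites `k, …, N`. -/
noncomputable def deviationTail (α β : ℝ) (L N : ℕ) (v : ℕ → ℝ) (k : ℕ) : ℝ :=
  ∑ j ∈ Finset.Ico k (N + 1), |v j - stablePoint α β L j|

theorem deviationTail_nonneg (α β : ℝ) (L N : ℕ) (v : ℕ → ℝ) (k : ℕ) :
    0 ≤ deviationTail α β L N v k := Finset.sum_nonneg fun _ _ => abs_nonneg _

theorem deviationTail_sub_succ (α β : ℝ) (L : ℕ) {N : ℕ} (v : ℕ → ℝ) {k : ℕ} (hk : k ≤ N) :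
    deviationTail α β L N v k - deviationTail α β L N v (k + 1) =
      |v k - stablePoint α β L k| := by
  unfold deviationTail
  rw [Finset.sum_eq_sum_Ico_succ_bot (by omega : k < N + 1)]
  ring

/-- The tails of the absolute deviation are subsolutions of a linear birth-death equation, up to
the flux entering from beyond the cut-off. -/
theorem IsSolution.exists_deriv_deviationTail (hu : IsSolution α β L u) (hα : 0 < α) (hβ : 0 < β)
    (hρ : α / β ≤ 1) (hL : 1 ≤ L) {t : ℝ} (ht : 0 ≤ t) {N k : ℕ} (hk : k < N) :
    ∃ d, HasDerivWithinAt (fun s => deviationTail α β L N (u s) (k + 1)) d (Set.Ici t) t ∧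
      d ≤ birthRate α (α / β) L k *
          (deviationTail α β L N (u t) k - deviationTail α β L N (u t) (k + 1)) -
        β * (deviationTail α β L N (u t) (k + 1) - deviationTail α β L N (u t) (k + 2)) +
        β * |u t (N + 1) - stablePoint α β L (N + 1)| := by
  rw [deviationTail_sub_succ α β L _ hk.le, deviationTail_sub_succ α β L _ (by omega)]
  set v := stablePoint α β L with hv
  have h0 := tails_nonneg (hu.mem t ht)
  have hv0 : ∀ k, 0 ≤ v k := fun k => (stablePoint_pos hα hβ L k).le
  have hρ0 : 0 < α / β := div_pos hα hβ
  choose d hd hle using fun k => hu.exists_deriv_abs_sub hα hβ ht k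
  -- `F` is a flux, so the sum telescopes to `F k - F N`. The nonnegative part of `F N` is dropped,
  -- and its other part is the flux through the cut-off.
  set F : ℕ → ℝ := fun k => α * powSlope L (u t k) (v k) * |u t k - v k| -
    β * |u t (k + 1) - v (k + 1)| with hF
  have hsum : ∀ s, deviationTail α β L N (u s) (k + 1) =
      ∑ j ∈ Finset.Ico k N, |u s (j + 1) - v (j + 1)| := fun s => by
    unfold deviationTail
    rw [Finset.sum_Ico_add' (fun j => |u s j - v j|) k N 1]
  refine ⟨∑ j ∈ Finset.Ico k N, d j, ?_, ?_⟩
  · simp only [hsum]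
    exact HasDerivWithinAt.fun_sum fun j _ => hd j
  · have h1 : ∑ j ∈ Finset.Ico k N, d j ≤ ∑ j ∈ Finset.Ico k N, (F j - F (j + 1)) :=
      Finset.sum_le_sum fun j _ => hle j
    have h2 : ∑ j ∈ Finset.Ico k N, (F j - F (j + 1)) = F k - F N := by
      rw [Finset.sum_Ico_eq_sub _ hk.le, Finset.sum_range_sub', Finset.sum_range_sub']
      ring
    have h3 : α * powSlope L (u t k) (v k) * |u t k - v k| ≤
        birthRate α (α / β) L k * |u t k - v k| := by
      by_cases hk0 : k = 0
      · have : u t k - v k = 0 := by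
          rw [hk0, (hu.mem t ht).1, hv, stablePoint_zero, sub_self]
        simp [this]
      · refine mul_le_mul_of_nonneg_right ?_ (abs_nonneg _)
        rw [birthRate, if_neg hk0]
        refine mul_le_mul_of_nonneg_left ?_ hα.le
        have hvk := stablePoint_le_pow hα hβ hρ hL k
        refine (powSlope_le (h0 k) (tails_le_one (hu.mem t ht) k) (hv0 k)
          (hvk.trans (pow_le_one₀ hρ0.le hρ)) hL).trans ?_
        have := mul_le_mul_of_nonneg_left hvk (Nat.cast_nonneg (α := ℝ) L)
        linarith
    have h4 : 0 ≤ α * powSlope L (u t N) (v N) * |u t N - v N| :=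
      mul_nonneg (mul_nonneg hα.le (powSlope_nonneg (h0 N) (hv0 N) L)) (abs_nonneg _)
    simp only [hF] at h1 h2 h3
    linarith

end Solution

/-! ### Energy estimate -/

section Energy

variable {α β θ : ℝ} {L : ℕ} {u : ℝ → ℕ → ℝ}

/-- Decay of the weighted energy of the deviation tails, up to the flux through the cut-off. -/
theorem IsSolution.energy_le (hu : IsSolution α β L u) (hα : 0 < α) (hβ : 0 < β)
    (hρ : α / β ≤ 1) (hL : 1 ≤ L) {φ ψ : ℕ → ℝ} {κ : ℝ}
    (hφ : ∀ k, 0 < φ k) (hψ0 : ψ 0 = 0) (hψ : ∀ k, 0 < ψ (k + 1))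
    (hGφ : ∀ k, birthRate α (α / β) L k * (φ k - φ (k + 1)) - β * (φ (k + 1) - φ (k + 2)) ≤
      -κ * φ (k + 1))
    (hGψ : ∀ k, birthRate α (α / β) L (k + 1) * ψ (k + 2) -
      (birthRate α (α / β) L k + β) * ψ (k + 1) + β * ψ k ≤ -κ * ψ (k + 1))
    (N : ℕ) {T : ℝ} (hT : 0 ≤ T) :
    Real.exp (2 * κ * T) *
        ∑ k ∈ Finset.range N, ψ (k + 1) / φ (k + 1) * deviationTail α β L N (u T) (k + 1) ^ 2 ≤
      ∑ k ∈ Finset.range N, ψ (k + 1) / φ (k + 1) * deviationTail α β L N (u 0) (k + 1) ^ 2 +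
      ∫ s in (0 : ℝ)..T, Real.exp (2 * κ * s) *
        (2 * β * (|u (max s 0) (N + 1) - stablePoint α β L (N + 1)| *
          ∑ k ∈ Finset.range N,
            ψ (k + 1) / φ (k + 1) * deviationTail α β L N (u (max s 0)) (k + 1))) := by
  have hcont : ∀ k, ContinuousOn (fun t => deviationTail α β L N (u t) k) (Set.Icc 0 T) :=
    fun k => continuousOn_finsetSum _ fun j _ =>
      (((hu.continuousOn j).mono Set.Icc_subset_Ici_self).sub continuousOn_const).abs
  have hcont' : ∀ k, Continuous fun t => deviationTail α β L N (u (max t 0)) k :=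
    fun k => continuous_finsetSum _ fun j _ => ((hu.continuous_max j).sub continuous_const).abs
  refine exp_mul_le_of_deriv_right_le (E := fun t => ∑ k ∈ Finset.range N,
    ψ (k + 1) / φ (k + 1) * deviationTail α β L N (u t) (k + 1) ^ 2) hT ?_ ?_ ?_
  · exact continuousOn_finsetSum _ fun k _ => continuousOn_const.mul ((hcont (k + 1)).pow 2)
  · refine continuous_const.mul (Continuous.mul ?_ ?_)
    · exact ((hu.continuous_max _).sub continuous_const).abs
    · exact continuous_finsetSum _ fun k _ => continuous_const.mul (hcont' (k + 1))
  · intro t ht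
    have ht0 : 0 ≤ t := ht.1
    rw [max_eq_left ht0]
    -- The guard `k < N` makes `d` a total function; its values beyond the cut-off play no role.
    have hex : ∀ k, ∃ d, k < N → HasDerivWithinAt
        (fun s => deviationTail α β L N (u s) (k + 1)) d (Set.Ici t) t ∧
        d ≤ birthRate α (α / β) L k *
            (deviationTail α β L N (u t) k - deviationTail α β L N (u t) (k + 1)) -
          β * (deviationTail α β L N (u t) (k + 1) - deviationTail α β L N (u t) (k + 2)) +
          β * |u t (N + 1) - stablePoint α β L (N + 1)| := fun k => by
      by_cases hk : k < N
      · obtain ⟨d, hd⟩ := hu.exists_deriv_deviationTail hα hβ hρ hL ht0 hk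
        exact ⟨d, fun _ => hd⟩
      · exact ⟨0, fun h => absurd h hk⟩
    choose d hd using hex
    refine ⟨_, HasDerivWithinAt.fun_sum fun k hk =>
      (((hd k (Finset.mem_range.1 hk)).1.pow 2).const_mul (ψ (k + 1) / φ (k + 1))), ?_⟩
    set Z := deviationTail α β L N (u t) with hZ
    set z := |u t (N + 1) - stablePoint α β L (N + 1)| with hz
    have hZ0 : ∀ k, 0 ≤ Z k := deviationTail_nonneg α β L N (u t)
    have hdiss := sum_weighted_birthDeath_le (N := N) (Z := Z) hβ.le
      (birthRate_nonneg hα.le (div_pos hα hβ).le L) (by simp [birthRate]) hφ hψ0 hψ hGφ hGψ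
      (by simp [hZ, deviationTail])
    have hpt : ∀ k ∈ Finset.range N,
        ψ (k + 1) / φ (k + 1) * (((2 : ℕ) : ℝ) * Z (k + 1) ^ (2 - 1) * d k) ≤
        ψ (k + 1) / φ (k + 1) * (2 * Z (k + 1) * (birthRate α (α / β) L k *
          (Z k - Z (k + 1)) - β * (Z (k + 1) - Z (k + 2)))) +
        2 * β * z * (ψ (k + 1) / φ (k + 1) * Z (k + 1)) := by
      intro k hk
      have h1 := mul_le_mul_of_nonneg_left (hd k (Finset.mem_range.1 hk)).2
        (mul_nonneg (div_pos (hψ k) (hφ (k + 1))).le (hZ0 (k + 1)))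
      norm_num
      linarith
    refine (Finset.sum_le_sum hpt).trans ?_
    rw [Finset.sum_add_distrib, ← Finset.mul_sum]
    linarith

/-- The flux term of the energy estimate, bounded by the last weighted square. -/
theorem sq_mul_sum_tail_le (hθ0 : 0 < θ) (hθ : θ < 1) {w z : ℕ → ℝ} {K B : ℝ}
    (hz : ∀ k, 0 ≤ z k) (hw0 : ∀ k, 0 ≤ w k) (hw : ∀ k, w k ≤ K * (θ ^ (k + 1))⁻¹) (N : ℕ)
    (hB : ∑ k ∈ Finset.range N, z (k + 1) ^ 2 * (θ ^ (k + 1))⁻¹ ≤ B) :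
    (z (N + 1) * ∑ k ∈ Finset.range N, w k * ∑ j ∈ Finset.Ico (k + 1) (N + 1), z j) ^ 2 ≤
      K ^ 2 * (θ / (1 - θ)) * (((1 - Real.sqrt θ) ^ 2)⁻¹ * B) *
        (z (N + 1) ^ 2 * (θ ^ (N + 1))⁻¹) := by
  set Z : ℕ → ℝ := fun k => ∑ j ∈ Finset.Ico (k + 1) (N + 1), z j with hZ
  have hZ0 : ∀ k, 0 ≤ Z k := fun k => Finset.sum_nonneg fun j _ => hz j
  have h1θ : 0 < 1 - θ := by linarith
  -- The sum grows like `(θ ^ N)⁻¹`, which is what the weight of `z (N + 1) ^ 2` absorbs.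
  have hgeom : ∑ k ∈ Finset.range N, (θ ^ (k + 1))⁻¹ ≤ (θ ^ N)⁻¹ / (1 - θ) := by
    clear hB hZ0 hZ Z
    induction N with
    | zero => simpa using (one_div_pos.2 h1θ).le
    | succ n ih =>
      rw [Finset.sum_range_succ]
      have : (θ ^ (n + 1))⁻¹ / (1 - θ) = (θ ^ n)⁻¹ / (1 - θ) + (θ ^ (n + 1))⁻¹ := by
        rw [pow_succ]
        field_simp
        ring
      linarith
  have hK : 0 ≤ K := by
    have := (hw0 0).trans (hw 0)
    have hp : 0 < (θ ^ (0 + 1))⁻¹ := by positivity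
    exact nonneg_of_mul_nonneg_left this hp
  have hcs := Finset.sum_mul_sq_le_sq_mul_sq (Finset.range N)
    (fun k => Real.sqrt (θ ^ (k + 1))⁻¹) (fun k => Real.sqrt (θ ^ (k + 1))⁻¹ * Z k)
  have hsq : ∀ k, Real.sqrt (θ ^ (k + 1))⁻¹ ^ 2 = (θ ^ (k + 1))⁻¹ := fun k =>
    Real.sq_sqrt (by positivity)
  have e1 : ∀ k, Real.sqrt (θ ^ (k + 1))⁻¹ * (Real.sqrt (θ ^ (k + 1))⁻¹ * Z k) =
      (θ ^ (k + 1))⁻¹ * Z k := fun k => by rw [← mul_assoc, ← sq, hsq]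
  have e2 : ∀ k, (Real.sqrt (θ ^ (k + 1))⁻¹ * Z k) ^ 2 = Z k ^ 2 * (θ ^ (k + 1))⁻¹ := fun k => by
    rw [mul_pow, hsq, mul_comm]
  simp only [e1, e2, hsq] at hcs
  have hH : ∑ k ∈ Finset.range N, Z k ^ 2 * (θ ^ (k + 1))⁻¹ ≤ ((1 - Real.sqrt θ) ^ 2)⁻¹ * B :=
    (sum_sq_tail_le hθ0 hθ z N).trans (mul_le_mul_of_nonneg_left hB (by positivity))
  have hwZ : ∑ k ∈ Finset.range N, w k * Z k ≤
      K * ∑ k ∈ Finset.range N, (θ ^ (k + 1))⁻¹ * Z k := by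
    rw [Finset.mul_sum]
    refine Finset.sum_le_sum fun k _ => ?_
    rw [← mul_assoc]
    exact mul_le_mul_of_nonneg_right (hw k) (hZ0 k)
  have hwZ0 : 0 ≤ ∑ k ∈ Finset.range N, w k * Z k :=
    Finset.sum_nonneg fun k _ => mul_nonneg (hw0 k) (hZ0 k)
  have h1 : (∑ k ∈ Finset.range N, w k * Z k) ^ 2 ≤
      K ^ 2 * ((θ ^ N)⁻¹ / (1 - θ) * (((1 - Real.sqrt θ) ^ 2)⁻¹ * B)) := by
    refine (pow_le_pow_left₀ hwZ0 hwZ 2).trans ?_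
    rw [mul_pow]
    refine mul_le_mul_of_nonneg_left (hcs.trans ?_) (sq_nonneg K)
    exact mul_le_mul hgeom hH (Finset.sum_nonneg fun k _ => by positivity) (by positivity)
  rw [mul_pow]
  refine (mul_le_mul_of_nonneg_left h1 (sq_nonneg _)).trans (le_of_eq ?_)
  rw [pow_succ θ N]
  field_simp

/-- The stable point lies in the weighted `ℓ²` space. -/
theorem sqSummable_stablePoint (hα : 0 < α) (hβ : 0 < β) (hL : 1 ≤ L) (hρθ : α / β ≤ θ)
    (hθ : θ < 1) : SqSummable (geom θ) (stablePoint α β L) := by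
  have hρ0 : 0 < α / β := div_pos hα hβ
  have hθ0 : 0 < θ := hρ0.trans_le hρθ
  refine Summable.of_nonneg_of_le (fun k => ?_) (fun k => ?_)
    ((summable_nat_add_iff 1).2 (summable_geometric_of_lt_one hθ0.le hθ))
  · unfold geom
    positivity
  · have h1 : stablePoint α β L (k + 1) ≤ θ ^ (k + 1) :=
      (stablePoint_le_pow hα hβ (hρθ.trans hθ.le) hL _).trans (pow_le_pow_left₀ hρ0.le hρθ _)
    have h2 := pow_le_pow_left₀ (stablePoint_pos hα hβ L (k + 1)).le h1 2
    unfold geom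
    rw [← div_eq_mul_inv, div_le_iff₀ (by positivity), ← sq]
    exact h2

/-- A bound, uniform on bounded time intervals, of the weighted norm of the deviation. -/
theorem IsSolution.exists_bound (hu : IsSolution α β L u) (hα : 0 < α) (hβ : 0 < β)
    (hL : 1 ≤ L) (hρθ : α / β ≤ θ) (hθ : θ < 1) (h0 : SqSummable (geom θ) (u 0)) (T : ℝ) :
    ∃ B, ∀ t, 0 ≤ t → t ≤ T → ∀ N, ∑ k ∈ Finset.range N,
      |u t (k + 1) - stablePoint α β L (k + 1)| ^ 2 * (θ ^ (k + 1))⁻¹ ≤ B := by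
  have hθ0 : 0 < θ := (div_pos hα hβ).trans_le hρθ
  have hs := sqSummable_stablePoint hα hβ hL hρθ hθ
  set a := ∑' k : ℕ, u 0 (k + 1) ^ 2 * (geom θ (k + 1))⁻¹ with ha
  set b := ∑' k : ℕ, stablePoint α β L (k + 1) ^ 2 * (geom θ (k + 1))⁻¹ with hb
  have hg : ∀ k, 0 ≤ (geom θ k)⁻¹ := fun k => by unfold geom; positivity
  have ha0 : 0 ≤ a := tsum_nonneg fun k => mul_nonneg (sq_nonneg _) (hg _)
  refine ⟨2 * (Real.exp (2 * α / θ * T) * (1 + a)) + 2 * b, fun t ht htT N => ?_⟩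
  have h1 := hu.weighted_sq_le hα hβ hL hθ0 N ht
  have h2 : ∑ k ∈ Finset.range N, u 0 (k + 1) ^ 2 * (θ ^ (k + 1))⁻¹ ≤ a :=
    h0.sum_le_tsum _ fun k _ => mul_nonneg (sq_nonneg _) (hg _)
  have h3 : ∑ k ∈ Finset.range N, stablePoint α β L (k + 1) ^ 2 * (θ ^ (k + 1))⁻¹ ≤ b :=
    hs.sum_le_tsum _ fun k _ => mul_nonneg (sq_nonneg _) (hg _)
  have h4 : Real.exp (2 * α / θ * t) *
      (1 + ∑ k ∈ Finset.range N, u 0 (k + 1) ^ 2 * (θ ^ (k + 1))⁻¹) ≤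
      Real.exp (2 * α / θ * T) * (1 + a) := by
    refine mul_le_mul (Real.exp_le_exp.2 ?_) (by linarith) ?_ (Real.exp_pos _).le
    · exact mul_le_mul_of_nonneg_left htT (by positivity)
    · have : 0 ≤ ∑ k ∈ Finset.range N, u 0 (k + 1) ^ 2 * (θ ^ (k + 1))⁻¹ :=
        Finset.sum_nonneg fun k _ => by positivity
      linarith
  have h5 : ∑ k ∈ Finset.range N,
      |u t (k + 1) - stablePoint α β L (k + 1)| ^ 2 * (θ ^ (k + 1))⁻¹ ≤
      2 * ∑ k ∈ Finset.range N, u t (k + 1) ^ 2 * (θ ^ (k + 1))⁻¹ +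
      2 * ∑ k ∈ Finset.range N, stablePoint α β L (k + 1) ^ 2 * (θ ^ (k + 1))⁻¹ := by
    rw [Finset.mul_sum, Finset.mul_sum, ← Finset.sum_add_distrib]
    refine Finset.sum_le_sum fun k _ => ?_
    have hp : 0 ≤ (θ ^ (k + 1))⁻¹ := by positivity
    have hq : |u t (k + 1) - stablePoint α β L (k + 1)| ^ 2 ≤
        2 * u t (k + 1) ^ 2 + 2 * stablePoint α β L (k + 1) ^ 2 := by
      rw [sq_abs]
      nlinarith [sq_nonneg (u t (k + 1) + stablePoint α β L (k + 1))]
    have := mul_le_mul_of_nonneg_right hq hp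
    linarith
  linarith

/-- Exponential decay of the truncated weighted norms, up to a vanishing error. -/
theorem IsSolution.exists_error (hu : IsSolution α β L u) (hα : 0 < α) (hβ : 0 < β)
    (hL : 1 ≤ L) (hρθ : α / β ≤ θ) (hθ : θ < 1) (h0 : SqSummable (geom θ) (u 0))
    {φ ψ : ℕ → ℝ} {κ K : ℝ} (hK : 0 < K)
    (hφ : ∀ k, 0 < φ k) (hψ0 : ψ 0 = 0) (hψ : ∀ k, 0 < ψ (k + 1))
    (hGφ : ∀ k, birthRate α (α / β) L k * (φ k - φ (k + 1)) - β * (φ (k + 1) - φ (k + 2)) ≤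
      -κ * φ (k + 1))
    (hGψ : ∀ k, birthRate α (α / β) L (k + 1) * ψ (k + 2) -
      (birthRate α (α / β) L k + β) * ψ (k + 1) + β * ψ k ≤ -κ * ψ (k + 1))
    (hlow : ∀ k, (θ ^ (k + 1))⁻¹ ≤ K * (ψ (k + 1) / φ (k + 1)))
    (hup : ∀ k, ψ (k + 1) / φ (k + 1) ≤ K * (θ ^ (k + 1))⁻¹) {T : ℝ} (hT : 0 ≤ T) :
    ∃ I : ℕ → ℝ, Tendsto I atTop (𝓝 0) ∧ ∀ N,
      Real.exp (2 * κ * T) * ∑ k ∈ Finset.range N,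
          |u T (k + 1) - stablePoint α β L (k + 1)| ^ 2 * (θ ^ (k + 1))⁻¹ ≤
        K ^ 2 * ((1 - Real.sqrt θ) ^ 2)⁻¹ * (∑ k ∈ Finset.range N,
          |u 0 (k + 1) - stablePoint α β L (k + 1)| ^ 2 * (θ ^ (k + 1))⁻¹) + K * I N := by
  have hθ0 : 0 < θ := (div_pos hα hβ).trans_le hρθ
  obtain ⟨B, hB⟩ := hu.exists_bound hα hβ hL hρθ hθ h0 T
  set z : ℝ → ℕ → ℝ := fun s k => |u (max s 0) k - stablePoint α β L k| with hz
  have hzc : ∀ k, Continuous fun s => z s k := fun k =>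
    ((hu.continuous_max k).sub continuous_const).abs
  have hz0 : ∀ s k, 0 ≤ z s k := fun s k => abs_nonneg _
  have hBz : ∀ s ≤ T, ∀ N, ∑ k ∈ Finset.range N, z s (k + 1) ^ 2 * (θ ^ (k + 1))⁻¹ ≤ B :=
    fun s hs N => hB _ (le_max_right _ _) (max_le hs hT) N
  set D := K ^ 2 * (θ / (1 - θ)) * (((1 - Real.sqrt θ) ^ 2)⁻¹ * B) with hD
  have hB0 : 0 ≤ B := by simpa using hBz T le_rfl 0
  have h1θ : 0 < 1 - θ := by linarith
  have hD0 : 0 ≤ D := by positivity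
  set ε : ℕ → ℝ → ℝ := fun N s => Real.exp (2 * κ * s) *
        (2 * β * (|u (max s 0) (N + 1) - stablePoint α β L (N + 1)| *
          ∑ k ∈ Finset.range N,
            ψ (k + 1) / φ (k + 1) * deviationTail α β L N (u (max s 0)) (k + 1))) with hε
  have hdc : ∀ N k, Continuous fun t => deviationTail α β L N (u (max t 0)) k :=
    fun N k => continuous_finsetSum _ fun j _ => hzc j
  have hεc : ∀ N, Continuous (ε N) := fun N => by
    refine Continuous.mul (by fun_prop) (continuous_const.mul ((hzc (N + 1)).mul ?_))
    exact continuous_finsetSum _ fun k _ => continuous_const.mul (hdc N (k + 1))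
  have hεb : ∀ N, ∀ s ≤ T, |ε N s| ≤ Real.exp (2 * κ * s) * (2 * β *
      Real.sqrt (D * (z s (N + 1) ^ 2 * (θ ^ (N + 1))⁻¹))) := by
    intro N s hs
    simp only [hε]
    rw [abs_mul, abs_of_pos (Real.exp_pos _), abs_mul, abs_of_pos (by positivity : 0 < 2 * β)]
    refine mul_le_mul_of_nonneg_left (mul_le_mul_of_nonneg_left ?_ (by positivity))
      (Real.exp_pos _).le
    exact Real.abs_le_sqrt (sq_mul_sum_tail_le hθ0 hθ (z := z s) (hz0 s)
      (fun k => (div_pos (hψ k) (hφ (k + 1))).le) hup N (hBz s hs N))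
  refine ⟨fun N => ∫ s in (0 : ℝ)..T, ε N s, ?_, fun N => ?_⟩
  · have hlim : Tendsto (fun N => ∫ s in (0 : ℝ)..T, ε N s) atTop
        (𝓝 (∫ s in (0 : ℝ)..T, (0 : ℝ))) := by
      refine intervalIntegral.tendsto_integral_filter_of_dominated_convergence
        (fun s => Real.exp (2 * κ * s) * (2 * β * Real.sqrt (D * B))) ?_ ?_ ?_ ?_
      · exact Eventually.of_forall fun N => (hεc N).aestronglyMeasurable
      · refine Eventually.of_forall fun N => Eventually.of_forall fun s hs => ?_
        rw [Set.uIoc_of_le hT] at hs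
        refine (hεb N s hs.2).trans ?_
        refine mul_le_mul_of_nonneg_left (mul_le_mul_of_nonneg_left ?_ (by positivity))
          (Real.exp_pos _).le
        refine Real.sqrt_le_sqrt (mul_le_mul_of_nonneg_left ?_ hD0)
        refine le_trans ?_ (hBz s hs.2 (N + 1))
        exact Finset.single_le_sum (f := fun k => z s (k + 1) ^ 2 * (θ ^ (k + 1))⁻¹)
          (fun k _ => by positivity) (Finset.self_mem_range_succ N)
      · exact Continuous.intervalIntegrable (by fun_prop) _ _
      · refine Eventually.of_forall fun s hs => ?_
        rw [Set.uIoc_of_le hT] at hs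
        refine squeeze_zero_norm (fun N => hεb N s hs.2) ?_
        have hsum : Summable fun k => z s (k + 1) ^ 2 * (θ ^ (k + 1))⁻¹ :=
          summable_of_sum_range_le (fun k => by positivity) (hBz s hs.2)
        have h1 := hsum.tendsto_atTop_zero.const_mul D
        have h2 := ((h1.sqrt).const_mul (2 * β)).const_mul (Real.exp (2 * κ * s))
        simpa using h2
    simpa using hlim
  · have hen := hu.energy_le hα hβ (hρθ.trans hθ.le) hL hφ hψ0 hψ hGφ hGψ N hT
    have hl : ∑ k ∈ Finset.range N,
        |u T (k + 1) - stablePoint α β L (k + 1)| ^ 2 * (θ ^ (k + 1))⁻¹ ≤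
        K * ∑ k ∈ Finset.range N,
          ψ (k + 1) / φ (k + 1) * deviationTail α β L N (u T) (k + 1) ^ 2 := by
      rw [Finset.mul_sum]
      refine Finset.sum_le_sum fun k hk => ?_
      have hk' := Finset.mem_range.1 hk
      have hle : |u T (k + 1) - stablePoint α β L (k + 1)| ≤
          deviationTail α β L N (u T) (k + 1) :=
        Finset.single_le_sum (f := fun j => |u T j - stablePoint α β L j|)
          (fun j _ => abs_nonneg _) (Finset.mem_Ico.2 ⟨le_rfl, by omega⟩)
      have h2 := mul_le_mul (pow_le_pow_left₀ (abs_nonneg _) hle 2) (hlow k) (by positivity)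
        (sq_nonneg _)
      linarith
    have hr : ∑ k ∈ Finset.range N,
        ψ (k + 1) / φ (k + 1) * deviationTail α β L N (u 0) (k + 1) ^ 2 ≤
        K * (((1 - Real.sqrt θ) ^ 2)⁻¹ * ∑ k ∈ Finset.range N,
          |u 0 (k + 1) - stablePoint α β L (k + 1)| ^ 2 * (θ ^ (k + 1))⁻¹) := by
      refine le_trans ?_ (mul_le_mul_of_nonneg_left (sum_sq_tail_le hθ0 hθ
        (fun j => |u 0 j - stablePoint α β L j|) N) hK.le)
      rw [Finset.mul_sum]
      refine Finset.sum_le_sum fun k _ => ?_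
      have := mul_le_mul_of_nonneg_right (hup k) (sq_nonneg (deviationTail α β L N (u 0) (k + 1)))
      unfold deviationTail at this ⊢
      linarith
    have h1 := mul_le_mul_of_nonneg_left hl (Real.exp_pos (2 * κ * T)).le
    have h2 := mul_le_mul_of_nonneg_left hen hK.le
    have h3 := mul_le_mul_of_nonneg_left hr hK.le
    simp only [hε]
    linarith

end Energy

end LoadBalancing

/-! ### Removal of the cut-off -/

theorem theorem2p11 (α β : ℝ) (hα : 0 < α) (hβ : 0 < β) (L : ℕ) (hL : 1 ≤ L)
    (θ : ℝ) (hρθ : α / β ≤ θ) (hθ : θ < 1) :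
    ∃ γ : ℝ, 0 < γ ∧ ∃ C : ℝ, ∀ u : ℝ → ℕ → ℝ,
      LoadBalancing.IsSolution α β L u →
      u 0 ∈ LoadBalancing.tailsL2 (LoadBalancing.geom θ) →
      ∀ t : ℝ, 0 ≤ t →
        u t - LoadBalancing.stablePoint α β L ∈ LoadBalancing.L2 (LoadBalancing.geom θ) ∧
        LoadBalancing.L2norm (LoadBalancing.geom θ) (u t - LoadBalancing.stablePoint α β L) ≤
          Real.exp (-γ * t) * C *
            LoadBalancing.L2norm (LoadBalancing.geom θ)
              (u 0 - LoadBalancing.stablePoint α β L) := by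
  open LoadBalancing Filter Topology in
  obtain ⟨κ, hκ, K, hK, φ, ψ, hφ, hψ0, hψ, hGφ, hGψ, hlow, hup⟩ :=
    exists_supersolutions hα hβ L hρθ hθ
  have hθ0 : 0 < θ := (div_pos hα hβ).trans_le hρθ
  set H := K ^ 2 * ((1 - Real.sqrt θ) ^ 2)⁻¹ with hH
  -- The squared norm decays at rate `2κ` with constant `H`; square roots give `κ` and `√H`.
  refine ⟨κ, hκ, Real.sqrt H, fun u hu hu0 t ht => ?_⟩
  have hsum : ∀ s, 0 ≤ s → Summable fun k : ℕ =>
      |u s (k + 1) - stablePoint α β L (k + 1)| ^ 2 * (θ ^ (k + 1))⁻¹ := fun s hs => by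
    obtain ⟨B, hB⟩ := hu.exists_bound hα hβ hL hρθ hθ hu0.2 s
    exact summable_of_sum_range_le (fun k => by positivity) (hB s hs le_rfl)
  have heq : ∀ s k, (u s - stablePoint α β L) (k + 1) ^ 2 * (geom θ (k + 1))⁻¹ =
      |u s (k + 1) - stablePoint α β L (k + 1)| ^ 2 * (θ ^ (k + 1))⁻¹ := fun s k => by
    rw [sq_abs, Pi.sub_apply, geom]
  refine ⟨⟨?_, ?_⟩, ?_⟩
  · rw [Pi.sub_apply, (hu.mem t ht).1, stablePoint_zero, sub_self]
  · unfold SqSummable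
    simpa only [heq] using hsum t ht
  · obtain ⟨I, hI, hle⟩ := hu.exists_error hα hβ hL hρθ hθ hu0.2 hK hφ hψ0 hψ hGφ hGψ hlow hup ht
    have hlim := le_of_tendsto_of_tendsto'
      (((hsum t ht).hasSum.tendsto_sum_nat).const_mul (Real.exp (2 * κ * t)))
      ((((hsum 0 le_rfl).hasSum.tendsto_sum_nat).const_mul H).add (hI.const_mul K)) hle
    rw [mul_zero, add_zero] at hlim
    unfold L2norm
    simp only [heq]
    set X := ∑' k : ℕ, |u t (k + 1) - stablePoint α β L (k + 1)| ^ 2 * (θ ^ (k + 1))⁻¹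
    set Y := ∑' k : ℕ, |u 0 (k + 1) - stablePoint α β L (k + 1)| ^ 2 * (θ ^ (k + 1))⁻¹
    have hexp : Real.exp (-κ * t) ^ 2 * Real.exp (2 * κ * t) = 1 := by
      rw [← Real.exp_nat_mul, ← Real.exp_add, ← Real.exp_zero]
      congr 1
      push_cast
      ring
    have hX : X ≤ Real.exp (-κ * t) ^ 2 * (H * Y) := by
      have h := mul_le_mul_of_nonneg_left hlim (sq_nonneg (Real.exp (-κ * t)))
      rwa [← mul_assoc, hexp, one_mul] at h
    refine (Real.sqrt_le_sqrt hX).trans (le_of_eq ?_)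
    rw [Real.sqrt_mul (sq_nonneg _), Real.sqrt_sq (Real.exp_pos _).le,
      Real.sqrt_mul (by positivity), mul_assoc]
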